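/- Let $(X,\mu)$ be a probability space and let $T\colon X\to X$ be a weakly mixing measure-preserving map, i.e. $\frac1N\sum_{i=0}^{N-1}\left|\mu(T^{-i}A\cap B)-\mu(A)\mu(B)\right|\to 0$ as $N\to\infty$ for all measurable sets $A,B$. For a (real- or complex-valued) function $f$ on $X$ and $n\ge 0$ write $T^nf=f\circ T^n$. Then the following hold for every $m$. $(2,m)$ For all $f_1,\dots,f_m\in L^\infty(X,\mu)$, $$\frac1N\sum_{i=1}^N\ \prod_{p=1}^m T^{pi}f_p\ \longrightarrow\ \prod_{p=1}^m\int f_p\,d\mu\qquad (N\to\infty)$$ in $L^2(X,\mu)$. $(1,m)$ For all $f_0,f_1,\dots,f_m\in L^\infty(X,\mu)$, $$\frac1N\sum_{i=1}^N\int f_0\prod_{p=1}^m T^{pi}f_p\,d\mu\ \longrightarrow\ \prod_{p=0}^m\int f_p\,d\mu\qquad (N\to\infty).$$ -/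

import Mathlib

open MeasureTheory Filter Topology

/-- A measure-preserving map `T` of a probability space is weakly mixing if for all measurable sets
`A`, `B` one has `(1/N) ∑_{i < N} |μ(T⁻ⁱ A ∩ B) - μ(A) μ(B)| → 0` as `N → ∞`. -/
structure IsWeaklyMixing {X : Type*} [MeasurableSpace X] (T : X → X) (μ : Measure X)
    [IsProbabilityMeasure μ] : Prop extends MeasurePreserving T μ μ where
  tendsto_cesaro : ∀ A B : Set X, MeasurableSet A → MeasurableSet B →
    Tendsto (fun N : ℕ => (N : ℝ)⁻¹ *
        ∑ i ∈ Finset.range N, |μ.real (T^[i] ⁻¹' A ∩ B) - μ.real A * μ.real B|)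
      atTop (𝓝 0)

/-!
The proof is Furstenberg's: the `L²` convergence of the averages of `∏_{1 ≤ p ≤ m} f_p ∘ T^{pn}` is
proved by induction on `m`, and convergence of the integrals against `f_0` follows from it by the
Cauchy–Schwarz inequality (`tendsto_average_integral_prod_of_eLpNorm`).

For the passage from `m` to `m + 1`, write `f_{m+1}` as the sum of a function of mean zero and a
constant. The constant contributes the case `m`. If `f_{m+1}` has mean zero, the limit must be zero,
and the van der Corput lemma (`tendsto_average_of_correlations`) reduces this to the correlations of
`u_n = ∏_p f_p ∘ T^{pn}`. Since `μ` is invariant under `T^n`, the inner product of `u_n` and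
`u_{n+h}` equals `∫ g_1 ∏_{p ≥ 2} g_p ∘ T^{(p-1)n} dμ` with `g_p = (f_p ∘ T^{ph}) * conj f_p`. These
are integrals with only `m` nontrivial powers of `T`, so by the induction hypothesis they average
to `∏_p ∫ g_p dμ`. The factors `∫ g_p dμ` are bounded uniformly in `h`, and the last one is the
correlation of `f_{m+1} ∘ T^{(m+1)h}` with `conj f_{m+1}`. Its absolute value averages to zero over
`h`: weak mixing extends from sets to bounded functions by approximation
(`IsWeaklyMixing.tendsto_correlation`), and passing to the multiples of `m + 1` costs a factor of at
most `m + 1` in Cesàro averages of nonnegative sequences (`tendsto_average_mul_of_nonneg`).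

Averages over `1 ≤ n ≤ N` and products over `1 ≤ p ≤ m` are indexed by `Finset.range`, with `n + 1`
and `p + 1` in place of `n` and `p`.
-/

/-! ### Cesàro averages and the van der Corput lemma -/

/-- Shifting a bounded sequence does not change the limiting behaviour of its Cesàro averages. -/
theorem tendsto_average_shift_sub {𝕜 E : Type*} [RCLike 𝕜] [NormedAddCommGroup E]
    [NormedSpace 𝕜 E] {u : ℕ → E} {C : ℝ} (hu : ∀ n, ‖u n‖ ≤ C) (h : ℕ) :
    Tendsto (fun N : ℕ => (N : 𝕜)⁻¹ • ∑ n ∈ Finset.range N, u (n + h)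
      - (N : 𝕜)⁻¹ • ∑ n ∈ Finset.range N, u n) atTop (𝓝 0) := by
  have hlim : Tendsto (fun N : ℕ => (N : ℝ)⁻¹ * (2 * h * C)) atTop (𝓝 0) := by
    simpa using (tendsto_inv_atTop_nhds_zero_nat (𝕜 := ℝ)).mul_const (2 * h * C)
  refine squeeze_zero_norm (fun N => ?_) hlim
  have hsum : ∑ n ∈ Finset.range N, u (n + h) - ∑ n ∈ Finset.range N, u n
      = ∑ n ∈ Finset.range h, u (N + n) - ∑ n ∈ Finset.range h, u n := by
    have h1 := Finset.sum_range_add u N h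
    have h2 := Finset.sum_range_add u h N
    rw [add_comm h N] at h2
    simp only [add_comm _ h]
    rw [sub_eq_sub_iff_add_eq_add, add_comm _ (∑ n ∈ Finset.range h, u n), ← h2, h1, add_comm]
  rw [← smul_sub, hsum, norm_smul, norm_inv, RCLike.norm_natCast]
  gcongr
  calc _ ≤ ‖∑ n ∈ Finset.range h, u (N + n)‖ + ‖∑ n ∈ Finset.range h, u n‖ := norm_sub_le _ _
    _ ≤ h * C + h * C := by
      gcongr
      · simpa using norm_sum_le_of_le (Finset.range h) fun n _ => hu (N + n)
      · simpa using norm_sum_le_of_le (Finset.range h) fun n _ => hu n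
    _ = 2 * h * C := by ring

/-- Jensen's inequality for the squared norm of a Cesàro average. -/
theorem norm_average_sq_le {𝕜 E : Type*} [RCLike 𝕜] [NormedAddCommGroup E] [NormedSpace 𝕜 E]
    (w : ℕ → E) (N : ℕ) :
    ‖(N : 𝕜)⁻¹ • ∑ n ∈ Finset.range N, w n‖ ^ 2
      ≤ (N : ℝ)⁻¹ * ∑ n ∈ Finset.range N, ‖w n‖ ^ 2 := by
  rcases Nat.eq_zero_or_pos N with rfl | hN
  · simp
  have hN' : (0 : ℝ) < N := by exact_mod_cast hN
  rw [norm_smul, norm_inv, RCLike.norm_natCast, mul_pow]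
  calc ((N : ℝ)⁻¹) ^ 2 * ‖∑ n ∈ Finset.range N, w n‖ ^ 2
      ≤ ((N : ℝ)⁻¹) ^ 2 * (N * ∑ n ∈ Finset.range N, ‖w n‖ ^ 2) := by
        gcongr
        refine (pow_le_pow_left₀ (norm_nonneg _) (norm_sum_le _ _) 2).trans ?_
        simpa using sq_sum_le_card_mul_sum_sq (s := Finset.range N) (f := fun n => ‖w n‖)
    _ = _ := by field_simp

/-- A row of the symmetric Toeplitz matrix `(a |h - k|)` of size `H` has sum at most twice that of
`a 0, …, a (H - 1)`, since each value of `|h - k|` occurs at most twice. -/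
theorem sum_abs_sub_le {a : ℕ → ℝ} (ha : ∀ j, 0 ≤ a j) {h H : ℕ} (hh : h < H) :
    ∑ k ∈ Finset.range H, a (if h ≤ k then k - h else h - k) ≤ 2 * ∑ j ∈ Finset.range H, a j := by
  rw [two_mul, ← Finset.sum_range_add_sum_Ico _ hh.le]
  refine add_le_add ?_ ?_
  · calc ∑ k ∈ Finset.range h, a (if h ≤ k then k - h else h - k)
        = ∑ k ∈ Finset.range h, a (h - 1 - k + 1) := by
          refine Finset.sum_congr rfl fun k hk => ?_
          have := Finset.mem_range.1 hk
          rw [if_neg (by omega)]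
          congr 1
          omega
      _ = ∑ k ∈ Finset.range h, a (k + 1) := Finset.sum_range_reflect (fun k => a (k + 1)) h
      _ ≤ ∑ k ∈ Finset.range (h + 1), a k := by
          rw [Finset.sum_range_succ']
          linarith [ha 0]
      _ ≤ ∑ j ∈ Finset.range H, a j :=
          Finset.sum_le_sum_of_subset_of_nonneg (Finset.range_mono hh) fun j _ _ => ha j
  · rw [Finset.sum_Ico_eq_sum_range]
    calc _ = ∑ k ∈ Finset.range (H - h), a k := by simp
      _ ≤ _ := Finset.sum_le_sum_of_subset_of_nonneg (Finset.range_mono (Nat.sub_le _ _))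
          fun j _ _ => ha j

/-- The **van der Corput lemma**: a bounded sequence in an inner product space has Cesàro averages
tending to zero as soon as its correlations `c h = lim_N (1/N) ∑_{n < N} ⟪u n, u (n + h)⟫` exist
and tend to zero in absolute Cesàro mean. -/
theorem tendsto_average_of_correlations {𝕜 E : Type*} [RCLike 𝕜] [NormedAddCommGroup E]
    [InnerProductSpace 𝕜 E] {u : ℕ → E} {C : ℝ} (hu : ∀ n, ‖u n‖ ≤ C) {c : ℕ → 𝕜}
    (hc : ∀ h, Tendsto (fun N : ℕ => (N : 𝕜)⁻¹ * ∑ n ∈ Finset.range N, inner 𝕜 (u n) (u (n + h)))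
      atTop (𝓝 (c h)))
    (hc0 : Tendsto (fun H : ℕ => (H : ℝ)⁻¹ * ∑ h ∈ Finset.range H, ‖c h‖) atTop (𝓝 0)) :
    Tendsto (fun N : ℕ => (N : 𝕜)⁻¹ • ∑ n ∈ Finset.range N, u n) atTop (𝓝 0) := by
  have hC : 0 ≤ C := (norm_nonneg _).trans (hu 0)
  -- The averaged correlation of two shifts `h ≤ k` tends to `c (k - h)`.
  have hle : ∀ h k, h ≤ k → Tendsto (fun N : ℕ => (N : 𝕜)⁻¹ *
      ∑ n ∈ Finset.range N, inner 𝕜 (u (n + h)) (u (n + k))) atTop (𝓝 (c (k - h))) := by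
    intro h k hk
    have hb : ∀ n, ‖(inner 𝕜 (u n) (u (n + (k - h))) : 𝕜)‖ ≤ C * C := fun n =>
      (norm_inner_le_norm _ _).trans (mul_le_mul (hu _) (hu _) (norm_nonneg _) hC)
    have := (tendsto_average_shift_sub (𝕜 := 𝕜) hb h).add (hc (k - h))
    simp only [smul_eq_mul, zero_add, sub_add_cancel] at this
    refine this.congr fun N => ?_
    simp only [show ∀ n, n + h + (k - h) = n + k from fun n => by omega]
  have hsymm : ∀ h k, ∀ N : ℕ, RCLike.re ((N : 𝕜)⁻¹ *
      ∑ n ∈ Finset.range N, (inner 𝕜 (u (n + h)) (u (n + k)) : 𝕜)) = RCLike.re ((N : 𝕜)⁻¹ *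
      ∑ n ∈ Finset.range N, (inner 𝕜 (u (n + k)) (u (n + h)) : 𝕜)) := by
    intro h k N
    rw [← RCLike.conj_re]
    simp [map_sum, inner_conj_symm]
  have hre : ∀ h k, Tendsto (fun N : ℕ => RCLike.re ((N : 𝕜)⁻¹ *
      ∑ n ∈ Finset.range N, (inner 𝕜 (u (n + h)) (u (n + k)) : 𝕜)))
      atTop (𝓝 (RCLike.re (c (if h ≤ k then k - h else h - k)))) := by
    intro h k
    split_ifs with hk
    · exact (RCLike.continuous_re.tendsto _).comp (hle h k hk)
    · exact ((RCLike.continuous_re.tendsto _).comp (hle k h (le_of_not_ge hk))).congr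
        fun N => hsymm k h N
  rw [Metric.tendsto_atTop]
  intro ε hε
  -- Fix a window length `H` for which the Cesàro mean of `‖c‖` is small.
  obtain ⟨H, hH, hHpos⟩ : ∃ H : ℕ,
      (H : ℝ)⁻¹ * ∑ h ∈ Finset.range H, ‖c h‖ < ε ^ 2 / 4 ∧ 0 < H :=
    ((hc0.eventually (gt_mem_nhds (by positivity))).and (eventually_gt_atTop 0)).exists
  have hHr : (0 : ℝ) < H := by exact_mod_cast hHpos
  set D : ℕ → E := fun N => ∑ h ∈ Finset.range H, ((N : 𝕜)⁻¹ • ∑ n ∈ Finset.range N, u (n + h)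
      - (N : 𝕜)⁻¹ • ∑ n ∈ Finset.range N, u n) with hD
  have hDlim : Tendsto D atTop (𝓝 0) := by
    have := tendsto_finsetSum (Finset.range H)
      fun h _ => tendsto_average_shift_sub (𝕜 := 𝕜) hu h
    rwa [Finset.sum_const_zero] at this
  set S : ℕ → ℝ := fun N => ∑ h ∈ Finset.range H, ∑ k ∈ Finset.range H, RCLike.re ((N : 𝕜)⁻¹ *
      ∑ n ∈ Finset.range N, (inner 𝕜 (u (n + h)) (u (n + k)) : 𝕜)) with hS
  set L : ℝ := ∑ h ∈ Finset.range H, ∑ k ∈ Finset.range H,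
    RCLike.re (c (if h ≤ k then k - h else h - k)) with hL
  have hSlim : Tendsto S atTop (𝓝 L) :=
    tendsto_finsetSum _ fun h _ => tendsto_finsetSum _ fun k _ => hre h k
  have hLle : L ≤ H * (2 * ∑ j ∈ Finset.range H, ‖c j‖) := by
    calc L ≤ ∑ h ∈ Finset.range H, 2 * ∑ j ∈ Finset.range H, ‖c j‖ := by
          refine Finset.sum_le_sum fun h hh => ?_
          exact (Finset.sum_le_sum fun k _ => RCLike.re_le_norm _).trans
            (sum_abs_sub_le (fun j => norm_nonneg (c j)) (Finset.mem_range.1 hh))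
      _ = _ := by simp
  -- Up to the shift error `D N`, the vector `H • (1/N) ∑ u n` is the average of the windowed sums
  -- `w n = ∑_{h < H} u (n + h)`, whose mean square expands into the correlations in `S N`.
  have hkey : ∀ N : ℕ, (H : ℝ) ^ 2 * ‖(N : 𝕜)⁻¹ • ∑ n ∈ Finset.range N, u n‖ ^ 2
      ≤ 2 * S N + 2 * ‖D N‖ ^ 2 := by
    intro N
    set w : ℕ → E := fun n => ∑ h ∈ Finset.range H, u (n + h) with hw
    have h1 : (H : 𝕜) • ((N : 𝕜)⁻¹ • ∑ n ∈ Finset.range N, u n)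
        = (N : 𝕜)⁻¹ • ∑ n ∈ Finset.range N, w n - D N := by
      simp only [hD, hw, Finset.sum_sub_distrib, Finset.sum_const, Finset.card_range]
      rw [Finset.sum_comm, Finset.smul_sum (s := Finset.range H), sub_sub_cancel,
          Nat.cast_smul_eq_nsmul]
    have h2 : (N : ℝ)⁻¹ * ∑ n ∈ Finset.range N, ‖w n‖ ^ 2 = S N := by
      have : ∀ n, ‖w n‖ ^ 2 = ∑ h ∈ Finset.range H, ∑ k ∈ Finset.range H,
          RCLike.re (inner 𝕜 (u (n + h)) (u (n + k)) : 𝕜) := by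
        intro n
        rw [← inner_self_eq_norm_sq (𝕜 := 𝕜)]
        simp only [hw, sum_inner, inner_sum, map_sum]
        exact Finset.sum_comm
      simp only [this, hS]
      rw [Finset.sum_comm, Finset.mul_sum]
      refine Finset.sum_congr rfl fun h _ => ?_
      rw [Finset.sum_comm, Finset.mul_sum]
      refine Finset.sum_congr rfl fun k _ => ?_
      rw [← map_sum, show ((N : 𝕜)⁻¹) = (((N : ℝ)⁻¹ : ℝ) : 𝕜) by push_cast; rfl,
        RCLike.re_ofReal_mul]
    calc (H : ℝ) ^ 2 * ‖(N : 𝕜)⁻¹ • ∑ n ∈ Finset.range N, u n‖ ^ 2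
        = ‖(N : 𝕜)⁻¹ • ∑ n ∈ Finset.range N, w n - D N‖ ^ 2 := by
          rw [← h1, norm_smul (H : 𝕜), RCLike.norm_natCast, mul_pow]
      _ ≤ (‖(N : 𝕜)⁻¹ • ∑ n ∈ Finset.range N, w n‖ + ‖D N‖) ^ 2 := by
          gcongr; exact norm_sub_le _ _
      _ ≤ 2 * (‖(N : 𝕜)⁻¹ • ∑ n ∈ Finset.range N, w n‖ ^ 2 + ‖D N‖ ^ 2) := add_sq_le
      _ ≤ 2 * S N + 2 * ‖D N‖ ^ 2 := by
          have := norm_average_sq_le (𝕜 := 𝕜) w N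
          rw [h2] at this
          linarith
  have hlim : Tendsto (fun N => 2 * S N + 2 * ‖D N‖ ^ 2) atTop (𝓝 (2 * L)) := by
    simpa using (hSlim.const_mul 2).add ((hDlim.norm.pow 2).const_mul 2)
  have hlt : 2 * L < (H : ℝ) ^ 2 * ε ^ 2 := by
    rw [inv_mul_lt_iff₀ hHr] at hH
    nlinarith
  obtain ⟨N₀, hN₀⟩ := eventually_atTop.1 (hlim.eventually (gt_mem_nhds hlt))
  refine ⟨N₀, fun N hN => ?_⟩
  rw [dist_zero_right]
  have := (hkey N).trans_lt (hN₀ N hN)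
  rw [← mul_pow, ← mul_pow] at this
  exact lt_of_mul_lt_mul_left (lt_of_pow_lt_pow_left₀ 2 (by positivity) this) hHr.le

/-- Sampling a nonnegative sequence along the multiples of `d` preserves vanishing of its Cesàro
averages. -/
theorem tendsto_average_mul_of_nonneg {a : ℕ → ℝ} (ha : ∀ n, 0 ≤ a n)
    (h : Tendsto (fun N : ℕ => (N : ℝ)⁻¹ * ∑ n ∈ Finset.range N, a n) atTop (𝓝 0))
    {d : ℕ} (hd : 0 < d) :
    Tendsto (fun N : ℕ => (N : ℝ)⁻¹ * ∑ n ∈ Finset.range N, a (d * n)) atTop (𝓝 0) := by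
  have h1 : Tendsto (fun N : ℕ => (d : ℝ) * (((d * N : ℕ) : ℝ)⁻¹ *
      ∑ n ∈ Finset.range (d * N), a n)) atTop (𝓝 0) := by
    simpa using (h.comp (tendsto_id.const_mul_atTop' hd)).const_mul (d : ℝ)
  refine squeeze_zero (fun N => mul_nonneg (by positivity) (Finset.sum_nonneg fun n _ => ha _))
    (fun N => ?_) h1
  have hd' : (d : ℝ) ≠ 0 := by exact_mod_cast hd.ne'
  rw [← mul_assoc, Nat.cast_mul, mul_inv, mul_inv_cancel_left₀ hd']
  gcongr
  rw [← Finset.sum_image (s := Finset.range N) (f := a) (g := fun n => d * n)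
    fun x _ y _ hxy => Nat.eq_of_mul_eq_mul_left hd hxy]
  refine Finset.sum_le_sum_of_subset_of_nonneg (fun k hk => ?_) fun k _ _ => ha k
  obtain ⟨n, hn, rfl⟩ := Finset.mem_image.1 hk
  exact Finset.mem_range.2 (Nat.mul_lt_mul_of_pos_left (Finset.mem_range.1 hn) hd)

theorem tendsto_average_norm_of_eq_add {E : Type*} [SeminormedAddCommGroup E]
    {a b c : ℕ → E} (habc : ∀ n, c n = a n + b n)
    (ha : Tendsto (fun N : ℕ => (N : ℝ)⁻¹ * ∑ n ∈ Finset.range N, ‖a n‖) atTop (𝓝 0))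
    (hb : Tendsto (fun N : ℕ => (N : ℝ)⁻¹ * ∑ n ∈ Finset.range N, ‖b n‖) atTop (𝓝 0)) :
    Tendsto (fun N : ℕ => (N : ℝ)⁻¹ * ∑ n ∈ Finset.range N, ‖c n‖) atTop (𝓝 0) := by
  have hab := ha.add hb
  rw [add_zero] at hab
  refine squeeze_zero (fun N => by positivity) (fun N => ?_) hab
  rw [← mul_add, ← Finset.sum_add_distrib]
  gcongr with n
  rw [habc]
  exact norm_add_le _ _

/-! ### Weak mixing for functions -/

theorem MeasureTheory.MemLp.exists_ae_norm_le {X E : Type*} [MeasurableSpace X] {μ : Measure X}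
    [NormedAddCommGroup E] {f : X → E} (hf : MemLp f ⊤ μ) :
    ∃ C : ℝ, 0 ≤ C ∧ ∀ᵐ x ∂μ, ‖f x‖ ≤ C := by
  refine ⟨(eLpNorm f ⊤ μ).toReal, ENNReal.toReal_nonneg, ?_⟩
  filter_upwards [ae_le_eLpNormEssSup (f := f) (μ := μ)] with x hx
  rw [← eLpNorm_exponent_top] at hx
  simpa using (ENNReal.toReal_le_toReal (by simp) hf.2.ne).2 hx

theorem MeasureTheory.MeasurePreserving.integral_comp_of_aestronglyMeasurable
    {X E : Type*} [MeasurableSpace X] {μ : Measure X} [NormedAddCommGroup E] [NormedSpace ℝ E]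
    {T : X → X} (hT : MeasurePreserving T μ μ) {f : X → E} (hf : AEStronglyMeasurable f μ) :
    ∫ x, f (T x) ∂μ = ∫ x, f x ∂μ := by
  rw [← integral_map hT.measurable.aemeasurable (by rwa [hT.map_eq]), hT.map_eq]

section correlation

variable {𝕜 : Type*} [RCLike 𝕜] {X : Type*} [MeasurableSpace X] {μ : Measure X}

/-- The correlation `∫ (f ∘ S) g dμ - ∫ f dμ ∫ g dμ` of `f` and `g` along the map `S`. -/
noncomputable def correlation (μ : Measure X) (S : X → X) (f g : X → 𝕜) : 𝕜 :=
  ∫ x, f (S x) * g x ∂μ - (∫ x, f x ∂μ) * ∫ x, g x ∂μ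

variable {S : X → X}

theorem integrable_comp_mul (hS : MeasurePreserving S μ μ) {f g : X → 𝕜}
    (h : (Integrable f μ ∧ MemLp g ⊤ μ) ∨ (MemLp f ⊤ μ ∧ Integrable g μ)) :
    Integrable (fun x => f (S x) * g x) μ := by
  rcases h with ⟨hf, hg⟩ | ⟨hf, hg⟩
  · obtain ⟨C, -, hC⟩ := hg.exists_ae_norm_le
    exact (hS.integrable_comp_of_integrable hf).mul_bdd (c := C) hg.1 hC
  · obtain ⟨C, -, hC⟩ := (hf.comp_measurePreserving hS).exists_ae_norm_le
    exact hg.bdd_mul (c := C) (hf.comp_measurePreserving hS).1 hC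

theorem correlation_add_left (hS : MeasurePreserving S μ μ) {f f' g : X → 𝕜}
    (hf : Integrable f μ) (hf' : Integrable f' μ) (hg : MemLp g ⊤ μ) :
    correlation μ S (f + f') g = correlation μ S f g + correlation μ S f' g := by
  simp only [correlation, Pi.add_apply, add_mul]
  rw [integral_add (integrable_comp_mul hS (.inl ⟨hf, hg⟩))
    (integrable_comp_mul hS (.inl ⟨hf', hg⟩)), integral_add hf hf']
  ring

theorem correlation_add_right (hS : MeasurePreserving S μ μ) {f g g' : X → 𝕜}
    (hf : MemLp f ⊤ μ) (hg : Integrable g μ) (hg' : Integrable g' μ) :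
    correlation μ S f (g + g') = correlation μ S f g + correlation μ S f g' := by
  simp only [correlation, Pi.add_apply, mul_add]
  rw [integral_add (integrable_comp_mul hS (.inr ⟨hf, hg⟩))
    (integrable_comp_mul hS (.inr ⟨hf, hg'⟩)), integral_add hg hg']
  ring

variable [IsProbabilityMeasure μ]

theorem norm_correlation_le_left (hS : MeasurePreserving S μ μ) {f g : X → 𝕜}
    (hf : Integrable f μ) {C : ℝ} (hC : ∀ᵐ x ∂μ, ‖g x‖ ≤ C) :
    ‖correlation μ S f g‖ ≤ 2 * C * ∫ x, ‖f x‖ ∂μ := by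
  have hfS : ∫ x, ‖f (S x)‖ ∂μ = ∫ x, ‖f x‖ ∂μ :=
    hS.integral_comp_of_aestronglyMeasurable hf.1.norm
  have h1 : ‖∫ x, f (S x) * g x ∂μ‖ ≤ C * ∫ x, ‖f x‖ ∂μ := by
    rw [← hfS, ← integral_const_mul]
    refine norm_integral_le_of_norm_le
      ((hS.integrable_comp_of_integrable hf).norm.const_mul C) ?_
    filter_upwards [hC] with x hx
    rw [norm_mul, mul_comm]
    exact mul_le_mul_of_nonneg_right hx (norm_nonneg _)
  have h2 : ‖(∫ x, f x ∂μ) * ∫ x, g x ∂μ‖ ≤ (∫ x, ‖f x‖ ∂μ) * C := by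
    rw [norm_mul]
    have : ‖∫ x, g x ∂μ‖ ≤ C := by simpa using norm_integral_le_of_norm_le_const hC
    exact mul_le_mul (norm_integral_le_integral_norm _) this (norm_nonneg _)
      (integral_nonneg fun _ => norm_nonneg _)
  calc _ ≤ _ := norm_sub_le _ _
    _ ≤ C * (∫ x, ‖f x‖ ∂μ) + (∫ x, ‖f x‖ ∂μ) * C := add_le_add h1 h2
    _ = _ := by ring

theorem norm_correlation_le_right (hS : MeasurePreserving S μ μ) {f g : X → 𝕜}
    (hg : Integrable g μ) {C : ℝ} (hC : ∀ᵐ x ∂μ, ‖f x‖ ≤ C) :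
    ‖correlation μ S f g‖ ≤ 2 * C * ∫ x, ‖g x‖ ∂μ := by
  have h1 : ‖∫ x, f (S x) * g x ∂μ‖ ≤ C * ∫ x, ‖g x‖ ∂μ := by
    rw [← integral_const_mul]
    refine norm_integral_le_of_norm_le (hg.norm.const_mul C) ?_
    filter_upwards [hS.quasiMeasurePreserving.ae hC] with x hx
    rw [norm_mul]
    exact mul_le_mul_of_nonneg_right hx (norm_nonneg _)
  have h2 : ‖(∫ x, f x ∂μ) * ∫ x, g x ∂μ‖ ≤ C * ∫ x, ‖g x‖ ∂μ := by
    rw [norm_mul]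
    have h3 : ‖∫ x, f x ∂μ‖ ≤ C := by simpa using norm_integral_le_of_norm_le_const hC
    exact mul_le_mul h3 (norm_integral_le_integral_norm _) (norm_nonneg _)
      ((norm_nonneg _).trans h3)
  calc _ ≤ _ := norm_sub_le _ _
    _ ≤ C * (∫ x, ‖g x‖ ∂μ) + C * (∫ x, ‖g x‖ ∂μ) := add_le_add h1 h2
    _ = _ := by ring

theorem MeasureTheory.SimpleFunc.integrable_of_isProbabilityMeasure (f : SimpleFunc X 𝕜) :
    Integrable f μ :=
  (f.memLp_top μ).integrable le_top

end correlation

theorem exists_simpleFunc_integral_norm_sub_lt {X 𝕜 : Type*} [RCLike 𝕜] [MeasurableSpace X]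
    {μ : Measure X} {f : X → 𝕜} (hf : Integrable f μ) {ε : ℝ} (hε : 0 < ε) :
    ∃ g : SimpleFunc X 𝕜, ∫ x, ‖f x - g x‖ ∂μ < ε := by
  obtain ⟨g, hg, hg'⟩ := (memLp_one_iff_integrable.2 hf).exists_simpleFunc_eLpNorm_sub_lt
    (by simp) (ε := ENNReal.ofReal ε) (by simpa using hε)
  refine ⟨g, ?_⟩
  change ∫ x, ‖(f - ⇑g) x‖ ∂μ < ε
  rw [integral_norm_eq_lintegral_enorm (hf.1.sub hg'.1), ← eLpNorm_one_eq_lintegral_enorm]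
  exact (ENNReal.lt_ofReal_iff_toReal_lt hg.ne_top).1 hg

section weaklyMixing

variable {𝕜 : Type*} [RCLike 𝕜] {X : Type*} [MeasurableSpace X] {μ : Measure X}
  [IsProbabilityMeasure μ] {T : X → X}

theorem IsWeaklyMixing.tendsto_correlation_indicator (hT : IsWeaklyMixing T μ) {A B : Set X}
    (hA : MeasurableSet A) (hB : MeasurableSet B) (a b : 𝕜) :
    Tendsto (fun N : ℕ => (N : ℝ)⁻¹ * ∑ i ∈ Finset.range N,
      ‖correlation μ T^[i] (A.indicator fun _ => a) (B.indicator fun _ => b)‖) atTop (𝓝 0) := by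
  have h := (hT.tendsto_cesaro A B hA hB).const_mul (‖a‖ * ‖b‖)
  rw [mul_zero] at h
  refine h.congr fun N => ?_
  rw [mul_left_comm, Finset.mul_sum]
  congr 1
  refine Finset.sum_congr rfl fun i _ => ?_
  have hAB : MeasurableSet (T^[i] ⁻¹' A ∩ B) := ((hT.measurable.iterate i) hA).inter hB
  have h1 : ∀ x, A.indicator (fun _ => a) (T^[i] x) * B.indicator (fun _ => b) x
      = (T^[i] ⁻¹' A ∩ B).indicator (fun _ => a * b) x := by
    intro x
    by_cases hx : T^[i] x ∈ A <;> by_cases hx' : x ∈ B <;> simp [Set.indicator, hx, hx']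
  simp only [correlation, h1, integral_indicator_const _ hAB, integral_indicator_const _ hA,
    integral_indicator_const _ hB, RCLike.real_smul_eq_coe_mul]
  rw [← RCLike.norm_ofReal (K := 𝕜) (_ - _), ← norm_mul, ← norm_mul]
  congr 1
  push_cast
  ring

theorem IsWeaklyMixing.tendsto_correlation_simpleFunc (hT : IsWeaklyMixing T μ)
    (f g : SimpleFunc X 𝕜) :
    Tendsto (fun N : ℕ => (N : ℝ)⁻¹ * ∑ i ∈ Finset.range N, ‖correlation μ T^[i] f g‖)
      atTop (𝓝 0) := by
  induction f using SimpleFunc.induction with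
  | const a hA =>
    induction g using SimpleFunc.induction with
    | const b hB =>
      simp only [SimpleFunc.coe_piecewise, SimpleFunc.coe_const, Function.const_zero,
        Set.piecewise_eq_indicator]
      exact hT.tendsto_correlation_indicator hA hB a b
    | @add g g' _ hg hg' =>
      refine tendsto_average_norm_of_eq_add (fun n => ?_) hg hg'
      rw [SimpleFunc.coe_add]
      exact correlation_add_right (hT.iterate n) (SimpleFunc.memLp_top _ μ)
        g.integrable_of_isProbabilityMeasure g'.integrable_of_isProbabilityMeasure
  | @add f f' _ hf hf' =>
    refine tendsto_average_norm_of_eq_add (fun n => ?_) hf hf'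
    rw [SimpleFunc.coe_add]
    exact correlation_add_left (hT.iterate n) f.integrable_of_isProbabilityMeasure
      f'.integrable_of_isProbabilityMeasure (g.memLp_top μ)

/-- Weak mixing, which is defined on measurable sets, extends to essentially bounded functions:
simple functions are dense in `L¹`, and the correlation of an integrable with a bounded function is
controlled by the `L¹` norm of the former. -/
theorem IsWeaklyMixing.tendsto_correlation (hT : IsWeaklyMixing T μ) {f g : X → 𝕜}
    (hf : MemLp f ⊤ μ) (hg : MemLp g ⊤ μ) :
    Tendsto (fun N : ℕ => (N : ℝ)⁻¹ * ∑ i ∈ Finset.range N, ‖correlation μ T^[i] f g‖)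
      atTop (𝓝 0) := by
  have hfi := hf.integrable le_top
  have hgi := hg.integrable le_top
  obtain ⟨C, hC0, hC⟩ := hg.exists_ae_norm_le
  rw [Metric.tendsto_atTop]
  intro ε hε
  obtain ⟨f', hf'⟩ := exists_simpleFunc_integral_norm_sub_lt hfi
    (ε := ε / (6 * (C + 1))) (by positivity)
  obtain ⟨C', hC'⟩ := f'.exists_forall_norm_le
  have hC'0 : 0 ≤ |C'| := abs_nonneg _
  -- The accuracy of the second approximation depends on the bound for the first one.
  obtain ⟨g', hg'⟩ := exists_simpleFunc_integral_norm_sub_lt hgi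
    (ε := ε / (6 * (|C'| + 1))) (by positivity)
  have hf'i : Integrable f' μ := f'.integrable_of_isProbabilityMeasure
  have hg'i : Integrable g' μ := g'.integrable_of_isProbabilityMeasure
  have hbound : ∀ i, ‖correlation μ T^[i] f g‖ ≤ ‖correlation μ T^[i] f' g'‖ + 2 * ε / 3 := by
    intro i
    have hS := hT.toMeasurePreserving.iterate i
    have h1 : correlation μ T^[i] f g = correlation μ T^[i] f' g'
        + correlation μ T^[i] f' (g - ⇑g') + correlation μ T^[i] (f - ⇑f') g := by
      rw [← correlation_add_right hS (f'.memLp_top μ) hg'i (hgi.sub hg'i), add_sub_cancel,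
        ← correlation_add_left hS hf'i (hfi.sub hf'i) hg, add_sub_cancel]
    have h2 : ‖correlation μ T^[i] (f - ⇑f') g‖ ≤ ε / 3 := by
      refine (norm_correlation_le_left hS (hfi.sub hf'i) hC).trans ?_
      calc 2 * C * ∫ x, ‖f x - f' x‖ ∂μ ≤ 2 * (C + 1) * (ε / (6 * (C + 1))) := by
            gcongr; linarith
        _ = ε / 3 := by field_simp; norm_num
    have h3 : ‖correlation μ T^[i] f' (g - ⇑g')‖ ≤ ε / 3 := by
      refine (norm_correlation_le_right hS (hgi.sub hg'i)
        (ae_of_all _ fun x => (hC' x).trans (le_abs_self C'))).trans ?_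
      calc 2 * |C'| * ∫ x, ‖g x - g' x‖ ∂μ ≤ 2 * (|C'| + 1) * (ε / (6 * (|C'| + 1))) := by
            gcongr; linarith
        _ = ε / 3 := by field_simp; norm_num
    rw [h1]
    refine (norm_add₃_le).trans ?_
    linarith
  obtain ⟨N₀, hN₀⟩ := eventually_atTop.1 ((hT.tendsto_correlation_simpleFunc f' g').eventually
    (gt_mem_nhds (show (0 : ℝ) < ε / 3 by positivity)))
  refine ⟨N₀, fun N hN => ?_⟩
  rw [dist_zero_right, Real.norm_of_nonneg (by positivity)]
  have h1 : (N : ℝ)⁻¹ * ∑ i ∈ Finset.range N, ‖correlation μ T^[i] f g‖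
      ≤ (N : ℝ)⁻¹ * ∑ i ∈ Finset.range N, ‖correlation μ T^[i] f' g'‖ + 2 * ε / 3 := by
    calc _ ≤ (N : ℝ)⁻¹ * ∑ i ∈ Finset.range N, (‖correlation μ T^[i] f' g'‖ + 2 * ε / 3) := by
          gcongr with i; exact hbound i
      _ = (N : ℝ)⁻¹ * ∑ i ∈ Finset.range N, ‖correlation μ T^[i] f' g'‖
          + ((N : ℝ)⁻¹ * N) * (2 * ε / 3) := by
          rw [Finset.sum_add_distrib, Finset.sum_const, Finset.card_range, nsmul_eq_mul]; ring
      _ ≤ _ := by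
          gcongr
          exact mul_le_of_le_one_left (by positivity) inv_mul_le_one
  linarith [hN₀ N hN]

end weaklyMixing

/-! ### Averages of products along multiples of the time -/

section products

variable {𝕜 : Type*} [RCLike 𝕜] {X : Type*} [MeasurableSpace X] {μ : Measure X}

theorem exists_ae_norm_le_of_forall_lt {m : ℕ} {f : ℕ → X → 𝕜}
    (hf : ∀ p < m, MemLp (f p) ⊤ μ) :
    ∃ C : ℝ, 0 ≤ C ∧ ∀ p < m, ∀ᵐ x ∂μ, ‖f p x‖ ≤ C := by
  have h : ∀ p, ∃ C : ℝ, 0 ≤ C ∧ (p < m → ∀ᵐ x ∂μ, ‖f p x‖ ≤ C) := by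
    intro p
    by_cases hp : p < m
    · obtain ⟨C, hC0, hC⟩ := (hf p hp).exists_ae_norm_le
      exact ⟨C, hC0, fun _ => hC⟩
    · exact ⟨0, le_rfl, fun h => absurd h hp⟩
  choose C hC0 hC using h
  refine ⟨∑ p ∈ Finset.range m, C p, Finset.sum_nonneg fun p _ => hC0 p, fun p hp => ?_⟩
  filter_upwards [hC p hp] with x hx
  exact hx.trans (Finset.single_le_sum (fun p _ => hC0 p) (Finset.mem_range.2 hp))

theorem norm_prod_range_le_pow {m : ℕ} {a : ℕ → 𝕜} {C : ℝ} (ha : ∀ p < m, ‖a p‖ ≤ C) :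
    ‖∏ p ∈ Finset.range m, a p‖ ≤ C ^ m := by
  rw [norm_prod]
  calc _ ≤ ∏ _p ∈ Finset.range m, C :=
        Finset.prod_le_prod (fun _ _ => norm_nonneg _) fun p hp => ha p (Finset.mem_range.1 hp)
    _ = C ^ m := by simp

variable {T : X → X}

theorem ae_norm_prod_iterate_le (hT : MeasurePreserving T μ μ) {m : ℕ} {f : ℕ → X → 𝕜} {C : ℝ}
    (hC : ∀ p < m, ∀ᵐ x ∂μ, ‖f p x‖ ≤ C) (k : ℕ → ℕ) :
    ∀ᵐ x ∂μ, ‖∏ p ∈ Finset.range m, f p (T^[k p] x)‖ ≤ C ^ m := by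
  have h : ∀ᵐ x ∂μ, ∀ p ∈ Finset.range m, ‖f p (T^[k p] x)‖ ≤ C :=
    (Finset.eventually_all _).2 fun p hp =>
      (hT.iterate (k p)).quasiMeasurePreserving.ae (hC p (Finset.mem_range.1 hp))
  filter_upwards [h] with x hx
  exact norm_prod_range_le_pow fun p hp => hx p (Finset.mem_range.2 hp)

theorem memLp_top_prod_iterate [IsFiniteMeasure μ] (hT : MeasurePreserving T μ μ) {m : ℕ}
    {f : ℕ → X → 𝕜} (hf : ∀ p < m, MemLp (f p) ⊤ μ) (k : ℕ → ℕ) :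
    MemLp (fun x => ∏ p ∈ Finset.range m, f p (T^[k p] x)) ⊤ μ := by
  obtain ⟨C, -, hC⟩ := exists_ae_norm_le_of_forall_lt hf
  refine memLp_top_of_bound ?_ (C ^ m) (ae_norm_prod_iterate_le hT hC k)
  exact Finset.aestronglyMeasurable_fun_prod _ fun p hp =>
    ((hf p (Finset.mem_range.1 hp)).comp_measurePreserving (hT.iterate (k p))).1

theorem enorm_integral_mul_le_eLpNorm_two {f g : X → 𝕜} (hf : AEStronglyMeasurable f μ)
    (hg : AEStronglyMeasurable g μ) :
    ‖∫ x, f x * g x ∂μ‖ₑ ≤ eLpNorm f 2 μ * eLpNorm g 2 μ := by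
  refine (enorm_integral_le_lintegral_enorm _).trans ?_
  rw [← eLpNorm_one_eq_lintegral_enorm]
  have := eLpNorm_smul_le_mul_eLpNorm (𝕜 := 𝕜) (E := 𝕜) (p := 2) (q := 2) (r := 1) hg hf
  exact this

theorem tendsto_integral_mul_of_eLpNorm {g : X → 𝕜} (hg : MemLp g 2 μ) {F : ℕ → X → 𝕜}
    (hF : ∀ N, AEStronglyMeasurable (F N) μ)
    (h : Tendsto (fun N => eLpNorm (F N) 2 μ) atTop (𝓝 0)) :
    Tendsto (fun N => ∫ x, g x * F N x ∂μ) atTop (𝓝 0) := by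
  have hlim := ENNReal.Tendsto.const_mul (a := eLpNorm g 2 μ) h (.inr hg.2.ne)
  rw [mul_zero] at hlim
  rw [tendsto_zero_iff_enorm_tendsto_zero]
  exact tendsto_of_tendsto_of_tendsto_of_le_of_le tendsto_const_nhds hlim (fun _ => zero_le)
    fun N => enorm_integral_mul_le_eLpNorm_two hg.1 (hF N)

variable [IsProbabilityMeasure μ]

/-- The van der Corput lemma in `L²(μ)`, for a uniformly bounded sequence of functions. -/
theorem tendsto_eLpNorm_average_of_correlations {F : ℕ → X → 𝕜} {C : ℝ}
    (hF : ∀ n, MemLp (F n) ⊤ μ) (hC : ∀ n, ∀ᵐ x ∂μ, ‖F n x‖ ≤ C) {c : ℕ → 𝕜}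
    (hc : ∀ h, Tendsto (fun N : ℕ => (N : 𝕜)⁻¹ *
      ∑ n ∈ Finset.range N, ∫ x, F (n + h) x * star (F n x) ∂μ) atTop (𝓝 (c h)))
    (hc0 : Tendsto (fun H : ℕ => (H : ℝ)⁻¹ * ∑ h ∈ Finset.range H, ‖c h‖) atTop (𝓝 0)) :
    Tendsto (fun N : ℕ => eLpNorm (fun x => (N : 𝕜)⁻¹ * ∑ n ∈ Finset.range N, F n x) 2 μ)
      atTop (𝓝 0) := by
  have hF2 : ∀ n, MemLp (F n) 2 μ := fun n => (hF n).mono_exponent le_top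
  set u : ℕ → Lp 𝕜 2 μ := fun n => (hF2 n).toLp (F n) with hu
  have hbound : ∀ n, ‖u n‖ ≤ max C 0 := by
    intro n
    rw [hu, Lp.norm_toLp]
    refine ENNReal.toReal_le_of_le_ofReal (le_max_right _ _) ?_
    refine (eLpNorm_le_of_ae_bound (C := max C 0) ?_).trans (by simp)
    filter_upwards [hC n] with x hx using hx.trans (le_max_left _ _)
  have hinner : ∀ n k, (inner 𝕜 (u n) (u k) : 𝕜) = ∫ x, F k x * star (F n x) ∂μ := by
    intro n k
    rw [L2.inner_def]
    refine integral_congr_ae ?_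
    filter_upwards [(hF2 n).coeFn_toLp, (hF2 k).coeFn_toLp] with x hx hx'
    rw [hx, hx', RCLike.inner_apply, starRingEnd_apply]
  have key := tendsto_average_of_correlations (𝕜 := 𝕜) hbound (c := c)
    (by simpa only [hinner] using hc) hc0
  have := (continuous_enorm.tendsto (0 : Lp 𝕜 2 μ)).comp key
  rw [enorm_zero] at this
  refine this.congr fun N => ?_
  rw [Function.comp_apply, Lp.enorm_def]
  refine eLpNorm_congr_ae ?_
  have hae : ∀ᵐ x ∂μ, ∀ n ∈ Finset.range N, u n x = F n x :=
    (Finset.eventually_all _).2 fun n _ => (hF2 n).coeFn_toLp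
  filter_upwards [Lp.coeFn_smul (N : 𝕜)⁻¹ (∑ n ∈ Finset.range N, u n),
    Lp.coeFn_finsetSum (Finset.range N) u, hae] with x h1 h2 h3
  rw [h1, Pi.smul_apply, h2, Finset.sum_apply, Finset.sum_congr rfl h3, smul_eq_mul]

/-- Convergence in `L²` of the averages of `∏_{1 ≤ p ≤ m} f_p ∘ T^{pn}` gives, by the
Cauchy–Schwarz inequality, convergence of their integrals against `f_0`. -/
theorem tendsto_average_integral_prod_of_eLpNorm (hT : MeasurePreserving T μ μ) {m : ℕ}
    {f : ℕ → X → 𝕜} (hf : ∀ p < m + 1, MemLp (f p) ⊤ μ)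
    (h : Tendsto (fun N : ℕ => eLpNorm (fun x => (N : 𝕜)⁻¹ * ∑ n ∈ Finset.range N,
      ∏ p ∈ Finset.range m, f (p + 1) (T^[(p + 1) * (n + 1)] x)
        - ∏ p ∈ Finset.range m, ∫ y, f (p + 1) y ∂μ) 2 μ) atTop (𝓝 0)) :
    Tendsto (fun N : ℕ => (N : 𝕜)⁻¹ * ∑ n ∈ Finset.range N,
      ∫ x, ∏ p ∈ Finset.range (m + 1), f p (T^[p * (n + 1)] x) ∂μ)
      atTop (𝓝 (∏ p ∈ Finset.range (m + 1), ∫ y, f p y ∂μ)) := by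
  have hf0 : MemLp (f 0) ⊤ μ := hf 0 (by omega)
  obtain ⟨C, -, hC⟩ := hf0.exists_ae_norm_le
  have hf02 : MemLp (f 0) 2 μ := hf0.mono_exponent le_top
  have hG : ∀ n, MemLp (fun x => ∏ p ∈ Finset.range m, f (p + 1) (T^[(p + 1) * (n + 1)] x)) ⊤ μ :=
    fun n => memLp_top_prod_iterate hT (f := fun p => f (p + 1)) (fun p hp => hf _ (by omega))
      fun p => (p + 1) * (n + 1)
  set G : ℕ → X → 𝕜 := fun n x => ∏ p ∈ Finset.range m, f (p + 1) (T^[(p + 1) * (n + 1)] x)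
  set c : 𝕜 := ∏ p ∈ Finset.range m, ∫ y, f (p + 1) y ∂μ
  have hint : ∀ n, Integrable (fun x => f 0 x * G n x) μ := fun n =>
    ((hG n).integrable le_top).bdd_mul hf0.1 hC
  have hA : ∀ N : ℕ, AEStronglyMeasurable
      (fun x => (N : 𝕜)⁻¹ * ∑ n ∈ Finset.range N, G n x - c) μ := fun N =>
    ((Finset.aestronglyMeasurable_fun_sum _ fun n _ => (hG n).1).const_mul _).sub
      aestronglyMeasurable_const
  have heq : ∀ N : ℕ, (N : 𝕜)⁻¹ * ∑ n ∈ Finset.range N,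
      ∫ x, ∏ p ∈ Finset.range (m + 1), f p (T^[p * (n + 1)] x) ∂μ
        - ∏ p ∈ Finset.range (m + 1), ∫ y, f p y ∂μ
      = ∫ x, f 0 x * ((N : 𝕜)⁻¹ * ∑ n ∈ Finset.range N, G n x - c) ∂μ := by
    intro N
    have h1 : ∀ x, f 0 x * ((N : 𝕜)⁻¹ * ∑ n ∈ Finset.range N, G n x - c)
        = (N : 𝕜)⁻¹ * ∑ n ∈ Finset.range N, f 0 x * G n x - f 0 x * c := by
      intro x
      rw [mul_sub, mul_left_comm, Finset.mul_sum]
    simp only [h1]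
    rw [integral_sub ((integrable_finsetSum _ fun n _ => hint n).const_mul _)
      ((hf0.integrable le_top).mul_const _), integral_const_mul,
      integral_finsetSum _ fun n _ => hint n, integral_mul_const]
    have h2 : ∀ n x, ∏ p ∈ Finset.range (m + 1), f p (T^[p * (n + 1)] x) = f 0 x * G n x := by
      intro n x
      rw [Finset.prod_range_succ', zero_mul, Function.iterate_zero, id_eq, mul_comm]
    simp only [h2]
    rw [Finset.prod_range_succ', mul_comm (∫ y, f 0 y ∂μ)]
  rw [← tendsto_sub_nhds_zero_iff]
  exact (tendsto_integral_mul_of_eLpNorm hf02 hA h).congr fun N => (heq N).symm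

/-- The correlations of the products `∏_{1 ≤ p ≤ m} f_p ∘ T^{pn}` at lag `h`: invariance of `μ`
under `T^n` lowers every exponent by one, which leaves a product of the functions
`(f_p ∘ T^{ph}) * conj f_p` along `0, n, …, (m - 1)n`. -/
theorem integral_prod_iterate_mul_star (hT : MeasurePreserving T μ μ) {m : ℕ}
    {f : ℕ → X → 𝕜} (hf : ∀ p < m, MemLp (f p) ⊤ μ) (n h : ℕ) :
    ∫ x, (∏ p ∈ Finset.range m, f p (T^[(p + 1) * (n + h)] x))
        * star (∏ p ∈ Finset.range m, f p (T^[(p + 1) * n] x)) ∂μ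
      = ∫ x, ∏ p ∈ Finset.range m, (fun y => f p (T^[(p + 1) * h] y) * star (f p y))
          (T^[p * n] x) ∂μ := by
  have hg : ∀ p < m, MemLp (fun y => f p (T^[(p + 1) * h] y) * star (f p y)) ⊤ μ := fun p hp =>
    (hf p hp).star.mul ((hf p hp).comp_measurePreserving (hT.iterate _))
  rw [← (hT.iterate n).integral_comp_of_aestronglyMeasurable
    (memLp_top_prod_iterate hT hg fun p => p * n).1]
  congr 1
  ext x
  rw [star_prod, ← Finset.prod_mul_distrib]
  refine Finset.prod_congr rfl fun p _ => ?_
  simp only [← Function.iterate_add_apply]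
  congr 4 <;> ring

/-- The mean zero case: if the last function has integral zero, then the averages tend to zero
in `L²`, provided that integrals of products with one exponent fewer converge. -/
theorem IsWeaklyMixing.tendsto_eLpNorm_average_prod_of_integral_eq_zero (hT : IsWeaklyMixing T μ)
    {m : ℕ} {f : ℕ → X → 𝕜} (hf : ∀ p < m + 1, MemLp (f p) ⊤ μ) (hfm : ∫ x, f m x ∂μ = 0)
    (hint : ∀ g : ℕ → X → 𝕜, (∀ p < m + 1, MemLp (g p) ⊤ μ) →
      Tendsto (fun N : ℕ => (N : 𝕜)⁻¹ * ∑ n ∈ Finset.range N,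
        ∫ x, ∏ p ∈ Finset.range (m + 1), g p (T^[p * (n + 1)] x) ∂μ)
        atTop (𝓝 (∏ p ∈ Finset.range (m + 1), ∫ y, g p y ∂μ))) :
    Tendsto (fun N : ℕ => eLpNorm (fun x => (N : 𝕜)⁻¹ * ∑ n ∈ Finset.range N,
      ∏ p ∈ Finset.range (m + 1), f p (T^[(p + 1) * (n + 1)] x)) 2 μ) atTop (𝓝 0) := by
  have hT' := hT.toMeasurePreserving
  obtain ⟨C, hC0, hC⟩ := exists_ae_norm_le_of_forall_lt hf
  refine tendsto_eLpNorm_average_of_correlations (C := C ^ (m + 1))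
    (c := fun h => ∏ p ∈ Finset.range (m + 1), ∫ x, f p (T^[(p + 1) * h] x) * star (f p x) ∂μ)
    (fun n => memLp_top_prod_iterate hT' hf fun p => (p + 1) * (n + 1))
    (fun n => ae_norm_prod_iterate_le hT' hC fun p => (p + 1) * (n + 1)) (fun h => ?_) ?_
  · refine (hint (fun p y => f p (T^[(p + 1) * h] y) * star (f p y)) fun p hp =>
      (hf p hp).star.mul ((hf p hp).comp_measurePreserving (hT'.iterate _))).congr fun N => ?_
    congr 1
    refine Finset.sum_congr rfl fun n _ => ?_
    rw [← integral_prod_iterate_mul_star hT' hf, add_right_comm]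
  · have hfL : MemLp (f m) ⊤ μ := hf m (by omega)
    have hstar : MemLp (fun x => star (f m x)) ⊤ μ := hfL.star
    have h0 := tendsto_average_mul_of_nonneg
      (a := fun i => ‖correlation μ T^[i] (f m) fun x => star (f m x)‖)
      (fun _ => norm_nonneg _) (hT.tendsto_correlation hfL hstar) m.succ_pos
    have h1 := h0.const_mul ((C * C) ^ m)
    rw [mul_zero] at h1
    refine squeeze_zero (fun H => by positivity) (fun H => ?_) h1
    rw [mul_left_comm, Finset.mul_sum _ _ ((C * C) ^ m)]
    gcongr with h
    rw [Finset.prod_range_succ, norm_mul]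
    gcongr
    · refine norm_prod_range_le_pow fun p hp => ?_
      have h2 : ∀ᵐ x ∂μ, ‖f p (T^[(p + 1) * h] x) * star (f p x)‖ ≤ C * C := by
        filter_upwards [hC p (by omega),
          (hT'.iterate ((p + 1) * h)).quasiMeasurePreserving.ae (hC p (by omega))] with x hx hx'
        rw [norm_mul, norm_star]
        exact mul_le_mul hx' hx (norm_nonneg _) hC0
      simpa using norm_integral_le_of_norm_le_const h2
    · simp [correlation, hfm]

/-- Convergence in `L²`, by induction on `m`: write the last function as the sum of a
function of mean zero and a constant. -/
theorem IsWeaklyMixing.tendsto_eLpNorm_average_prod (hT : IsWeaklyMixing T μ) (m : ℕ) :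
    ∀ f : ℕ → X → 𝕜, (∀ p < m, MemLp (f p) ⊤ μ) →
      Tendsto (fun N : ℕ => eLpNorm (fun x => (N : 𝕜)⁻¹ * ∑ n ∈ Finset.range N,
        ∏ p ∈ Finset.range m, f p (T^[(p + 1) * (n + 1)] x)
          - ∏ p ∈ Finset.range m, ∫ y, f p y ∂μ) 2 μ) atTop (𝓝 0) := by
  have hT' := hT.toMeasurePreserving
  induction m with
  | zero =>
    intro f _
    refine tendsto_const_nhds.congr' ?_
    filter_upwards [eventually_gt_atTop 0] with N hN
    have : (N : 𝕜) ≠ 0 := by exact_mod_cast hN.ne'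
    simp [this]
  | succ m ih =>
    intro f hf
    set a : 𝕜 := ∫ y, f m y ∂μ with ha
    set g : ℕ → X → 𝕜 := Function.update f m fun x => f m x - a with hg
    have hgm : g m = fun x => f m x - a := Function.update_self ..
    have hgp : ∀ p < m, g p = f p := fun p hp => Function.update_of_ne hp.ne _ _
    have hgL : ∀ p < m + 1, MemLp (g p) ⊤ μ := by
      intro p hp
      rcases (Nat.lt_succ_iff_lt_or_eq.1 hp) with hp' | rfl
      · rw [hgp p hp']; exact hf p hp
      · rw [hgm]; exact (hf p hp).sub (memLp_const a)
    have hgint : ∫ x, g m x ∂μ = 0 := by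
      rw [hgm, integral_sub ((hf m (by omega)).integrable le_top) (integrable_const a)]
      simp [ha]
    have h1 := hT.tendsto_eLpNorm_average_prod_of_integral_eq_zero hgL hgint fun g' hg' =>
      tendsto_average_integral_prod_of_eLpNorm hT' hg'
        (ih (fun p => g' (p + 1)) fun p hp => hg' _ (by omega))
    have h2 := ENNReal.Tendsto.const_mul (a := ‖a‖ₑ) (ih f fun p hp => hf p (by omega))
      (.inr enorm_ne_top)
    have h3 := h1.add h2
    rw [mul_zero, add_zero] at h3
    refine tendsto_of_tendsto_of_tendsto_of_le_of_le tendsto_const_nhds h3 (fun _ => zero_le)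
      fun N => ?_
    have hmeas : ∀ (k : ℕ) (f' : ℕ → X → 𝕜), (∀ p < k, MemLp (f' p) ⊤ μ) →
        AEStronglyMeasurable (fun x => (N : 𝕜)⁻¹ * ∑ n ∈ Finset.range N,
          ∏ p ∈ Finset.range k, f' p (T^[(p + 1) * (n + 1)] x)) μ := fun k f' hf' =>
      (Finset.aestronglyMeasurable_fun_sum _ fun n _ =>
        (memLp_top_prod_iterate hT' hf' fun p => (p + 1) * (n + 1)).1).const_mul _
    have hsplit : (fun x => (N : 𝕜)⁻¹ * ∑ n ∈ Finset.range N,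
        ∏ p ∈ Finset.range (m + 1), f p (T^[(p + 1) * (n + 1)] x)
          - ∏ p ∈ Finset.range (m + 1), ∫ y, f p y ∂μ)
        = (fun x => (N : 𝕜)⁻¹ * ∑ n ∈ Finset.range N,
            ∏ p ∈ Finset.range (m + 1), g p (T^[(p + 1) * (n + 1)] x))
          + a • fun x => (N : 𝕜)⁻¹ * ∑ n ∈ Finset.range N,
            ∏ p ∈ Finset.range m, f p (T^[(p + 1) * (n + 1)] x)
              - ∏ p ∈ Finset.range m, ∫ y, f p y ∂μ := by
      ext x
      have h4 : ∀ n, ∏ p ∈ Finset.range m, g p (T^[(p + 1) * (n + 1)] x)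
          = ∏ p ∈ Finset.range m, f p (T^[(p + 1) * (n + 1)] x) := fun n =>
        Finset.prod_congr rfl fun p hp => by rw [hgp p (Finset.mem_range.1 hp)]
      simp only [Pi.add_apply, Pi.smul_apply, smul_eq_mul, Finset.prod_range_succ, h4, hgm,
        mul_sub, Finset.sum_sub_distrib, ← Finset.sum_mul]
      rw [← ha]
      ring
    rw [hsplit]
    refine (eLpNorm_add_le (hmeas _ _ hgL) (((hmeas m f fun p hp => hf p (by omega)).sub
      aestronglyMeasurable_const).const_smul a) (by norm_num)).trans ?_
    rw [eLpNorm_const_smul]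
    exact le_rfl

end products

theorem mainTheorem2 {𝕜 : Type*} [RCLike 𝕜] {X : Type*} [MeasurableSpace X]
    (μ : Measure X) [IsProbabilityMeasure μ] (T : X → X) (hT : IsWeaklyMixing T μ) (m : ℕ) :
    (∀ f : ℕ → X → 𝕜, (∀ p ∈ Finset.Icc 1 m, MemLp (f p) ⊤ μ) →
      Tendsto (fun N : ℕ => eLpNorm (fun x =>
          (N : 𝕜)⁻¹ * ∑ i ∈ Finset.Icc 1 N, ∏ p ∈ Finset.Icc 1 m, f p (T^[p * i] x)
            - ∏ p ∈ Finset.Icc 1 m, ∫ y, f p y ∂μ) 2 μ)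
        atTop (𝓝 0)) ∧
    (∀ f : ℕ → X → 𝕜, (∀ p ∈ Finset.Icc 0 m, MemLp (f p) ⊤ μ) →
      Tendsto (fun N : ℕ => (N : 𝕜)⁻¹ * ∑ i ∈ Finset.Icc 1 N,
          ∫ x, f 0 x * ∏ p ∈ Finset.Icc 1 m, f p (T^[p * i] x) ∂μ)
        atTop (𝓝 (∏ p ∈ Finset.Icc 0 m, ∫ y, f p y ∂μ))) := by
  -- Reindex all sums and products by initial segments of `ℕ`.
  have hsum : ∀ (N : ℕ) (a : ℕ → 𝕜),
      ∑ i ∈ Finset.Icc 1 N, a i = ∑ i ∈ Finset.range N, a (i + 1) := fun N a => by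
    rw [← Finset.Ico_add_one_right_eq_Icc, Finset.sum_Ico_eq_sum_range]
    simp [add_comm]
  have hprod : ∀ (N : ℕ) (a : ℕ → 𝕜),
      ∏ i ∈ Finset.Icc 1 N, a i = ∏ i ∈ Finset.range N, a (i + 1) := fun N a => by
    rw [← Finset.Ico_add_one_right_eq_Icc, Finset.prod_Ico_eq_prod_range]
    simp [add_comm]
  have h2 : ∀ f : ℕ → X → 𝕜, (∀ p ∈ Finset.Icc 1 m, MemLp (f p) ⊤ μ) →
      Tendsto (fun N : ℕ => eLpNorm (fun x => (N : 𝕜)⁻¹ * ∑ n ∈ Finset.range N,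
        ∏ p ∈ Finset.range m, f (p + 1) (T^[(p + 1) * (n + 1)] x)
          - ∏ p ∈ Finset.range m, ∫ y, f (p + 1) y ∂μ) 2 μ) atTop (𝓝 0) := fun f hf =>
    hT.tendsto_eLpNorm_average_prod m (fun p => f (p + 1)) fun p hp =>
      hf _ (Finset.mem_Icc.2 ⟨by omega, by omega⟩)
  refine ⟨fun f hf => ?_, fun f hf => ?_⟩
  · simpa only [hsum, hprod] using h2 f hf
  · have h1 := tendsto_average_integral_prod_of_eLpNorm hT.toMeasurePreserving
      (fun p hp => hf p (Finset.mem_Icc.2 ⟨by omega, by omega⟩))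
      (h2 f fun p hp => hf p (Finset.mem_Icc.2 ⟨by omega, (Finset.mem_Icc.1 hp).2⟩))
    rw [show Finset.Icc 0 m = Finset.range (m + 1) by ext; simp]
    refine h1.congr fun N => ?_
    simp only [hsum, hprod, Finset.prod_range_succ', zero_mul, Function.iterate_zero, id_eq,
      mul_comm _ (f 0 _)]
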